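/- Notation. Let $L^1(\mathbb{R})$ be the real Lebesgue space and $L^\infty(\mathbb{R})$ the complex Banach space of essentially bounded functions on $\mathbb{R}$ modulo a.e. equality. Let $P(\mathbb{R})$ be the set of $f\in L^1(\mathbb{R})$ with $f\ge 0$ a.e. and $\int_{\mathbb{R}} f(t)\,dt=1$. A *topologically invariant mean* on $L^\infty(\mathbb{R})$ is a continuous linear functional $\Phi\in L^\infty(\mathbb{R})^*$ such that $\Phi(\phi)\ge 0$ whenever $\phi\ge 0$ a.e., $\Phi(1)=1$, and $\Phi(f*\phi)=\Phi(\phi)$ for all $f\in P(\mathbb{R})$ and $\phi\in L^\infty(\mathbb{R})$, where $(f*\phi)(x)=\int_{\mathbb{R}}\phi(x-t)f(t)\,dt$. Let $\mathbb{C}^+=\{z\in\mathbb{C}:\operatorname{Re} z>0\}$ and let $H^\infty(\mathbb{C}^+)$ be the algebra of bounded analytic functions on $\mathbb{C}^+$ with the supremum norm. Its maximal ideal space $\mathfrak{M}$ is the set of nonzero multiplicative continuous linear functionals $\chi:H^\infty(\mathbb{C}^+)\to\mathbb{C}$, with the weak* topology; for $z\in\mathbb{C}^+$ let $\hat z\in\mathfrak{M}$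 be the evaluation $\hat z(\phi)=\phi(z)$. A function $\psi\in L^\infty(\mathbb{R})$ is the *boundary function* of $\phi\in H^\infty(\mathbb{C}^+)$ if for a.e. $y\in\mathbb{R}$ the nontangential limit of $\phi$ at $iy$ exists and equals $\psi(y)$, that is, for every $M>0$, $\phi(z)\to\psi(y)$ as $z\to iy$ within $\{z\in\mathbb{C}^+:|\operatorname{Im} z-y|<M\operatorname{Re} z\}$. **Theorem 4.3.** Let $\chi\in\mathfrak{M}$ and suppose that there is a net $(z_\alpha)$ in $\mathbb{C}^+$ with $\operatorname{Re} z_\alpha\to\infty$ and $\hat z_\alpha\to\chi$ in the weak* topology. Then there exists a topologically invariant mean $\Phi$ on $L^\infty(\mathbb{R})$ whose restriction to $H^\infty(\mathbb{C}^+)$, embedded in $L^\infty(\mathbb{R})$ through boundary functions, is $\chi$: every $\phi\in H^\infty(\mathbb{C}^+)$ has a boundary function $\psi\in L^\infty(\mathbb{R})$, and $\Phi(\psi)=\chi(\phi)$. -/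

import Mathlib

open MeasureTheory Filter Topology
open scoped ENNReal ComplexOrder BoundedContinuousFunction Convolution

noncomputable section

namespace HalfPlane

/-! ### Means on `L^∞(ℝ)` -/

/-- The Banach space `L^∞(ℝ)` of complex essentially bounded functions modulo a.e. equality. -/
abbrev LInfty : Type := Lp ℂ ∞ (volume : Measure ℝ)

/-- The constant function `1` in `L^∞(ℝ)`. -/
def oneLInfty : LInfty := (memLp_top_const (1 : ℂ)).toLp (fun _ : ℝ => (1 : ℂ))

/-- The convolution `x ↦ ∫ f(t) φ(x - t) dt` of `f ∈ L^1(ℝ)` and `φ ∈ L^∞(ℝ)` is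
essentially bounded. -/
theorem memLp_convolution (f : Lp ℝ 1 (volume : Measure ℝ)) (φ : LInfty) :
    MemLp (f ⋆[ContinuousLinearMap.lsmul ℝ ℝ, volume] φ : ℝ → ℂ) ∞ volume := by
  have hf : Integrable (f : ℝ → ℝ) volume := L1.integrable_coeFn f
  have hm : AEStronglyMeasurable
      (f ⋆[ContinuousLinearMap.lsmul ℝ ℝ, volume] φ : ℝ → ℂ) volume :=
    (AEStronglyMeasurable.convolution_integrand (ContinuousLinearMap.lsmul ℝ ℝ)
      hf.aestronglyMeasurable (Lp.aestronglyMeasurable φ)).integral_prod_right'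
  have hb : ∀ᵐ y ∂(volume : Measure ℝ), ‖φ y‖ ≤ ‖φ‖ := by
    filter_upwards [ae_le_eLpNormEssSup (f := φ) (μ := volume)] with y hy
    rw [← eLpNorm_exponent_top, ← Lp.enorm_def] at hy
    exact enorm_le_iff_norm_le.mp hy
  refine memLp_top_of_bound hm (∫ t, ‖f t‖ * ‖φ‖) (Eventually.of_forall fun x => ?_)
  refine norm_integral_le_of_norm_le (hf.norm.mul_const _) ?_
  have hx : ∀ᵐ t ∂(volume : Measure ℝ), ‖φ (x - t)‖ ≤ ‖φ‖ :=
    (quasiMeasurePreserving_sub_left volume x).ae hb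
  filter_upwards [hx] with t ht
  simp only [ContinuousLinearMap.lsmul_apply, norm_smul]
  gcongr

/-- The convolution `f * φ` of `f ∈ L^1(ℝ)` and `φ ∈ L^∞(ℝ)`, as an element of `L^∞(ℝ)`. -/
def conv (f : Lp ℝ 1 (volume : Measure ℝ)) (φ : LInfty) : LInfty :=
  (memLp_convolution f φ).toLp _

/-- The set `P(ℝ)` of all `f ∈ L^1(ℝ)` with `f ≥ 0` and `∫ f = 1`. -/
def densities : Set (Lp ℝ 1 (volume : Measure ℝ)) :=
  {f | (∀ᵐ t, 0 ≤ f t) ∧ ∫ t, f t = 1}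

/-- A mean on `L^∞(ℝ)`: a continuous linear functional that is positive and normalized. -/
structure IsMean (Φ : StrongDual ℂ LInfty) : Prop where
  /-- `0 ≤ w` for a complex number `w` means that `w` is real and nonnegative. -/
  nonneg : ∀ φ : LInfty, (∀ᵐ t, 0 ≤ φ t) → 0 ≤ Φ φ
  map_one : Φ oneLInfty = 1

/-- A topologically invariant mean: `Φ (f * φ) = Φ φ` for all `f ∈ P(ℝ)`, `φ ∈ L^∞(ℝ)`. -/
structure IsTopologicallyInvariantMean (Φ : StrongDual ℂ LInfty) : Prop extends IsMean Φ where
  map_conv : ∀ f ∈ densities, ∀ φ : LInfty, Φ (conv f φ) = Φ φ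

/-! ### Bounded analytic functions on the right half plane -/

/-- The open right half plane `ℂ⁺`. -/
def rightHalfPlane : Set ℂ := {z | 0 < z.re}

/-- The algebra `H^∞(ℂ⁺)` of bounded analytic functions on the right half plane, with pointwise
operations and the supremum norm. -/
def HInfty : Subalgebra ℂ (rightHalfPlane →ᵇ ℂ) where
  carrier := {φ | ∃ g : ℂ → ℂ, DifferentiableOn ℂ g rightHalfPlane ∧
    ∀ z : rightHalfPlane, φ z = g z}
  mul_mem' := by
    rintro a b ⟨g, hg, ha⟩ ⟨h, hh, hb⟩
    exact ⟨fun z => g z * h z, hg.mul hh, fun z => by simp [ha, hb]⟩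
  add_mem' := by
    rintro a b ⟨g, hg, ha⟩ ⟨h, hh, hb⟩
    exact ⟨fun z => g z + h z, hg.add hh, fun z => by simp [ha, hb]⟩
  algebraMap_mem' := fun c =>
    ⟨fun _ => c, differentiableOn_const c, fun z => by simp⟩

/-- The maximal ideal space `𝔐` of `H^∞(ℂ⁺)`: the nonzero multiplicative continuous linear
functionals, with the weak* topology. -/
abbrev MaximalIdealSpace : Type := WeakDual.characterSpace ℂ HInfty

/-- Evaluation at a point of the right half plane, as a point of the maximal ideal space. -/
def pointEval (z : rightHalfPlane) : MaximalIdealSpace :=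
  ⟨StrongDual.toWeakDual
      ((BoundedContinuousFunction.evalCLM ℂ z).comp
        (Subalgebra.toSubmodule HInfty).subtypeL), by
    refine ⟨fun h => ?_, fun φ ψ => rfl⟩
    have h1 : (1 : ℂ) = 0 := DFunLike.congr_fun h (1 : HInfty)
    exact one_ne_zero h1⟩

theorem pointEval_apply (z : rightHalfPlane) (φ : HInfty) :
    pointEval z φ = (φ : rightHalfPlane →ᵇ ℂ) z := rfl

/-- The nontangential approach region at the boundary point `iy` with aperture `M`. -/
def approachRegion (M y : ℝ) : Set ℂ := {z | 0 < z.re ∧ |z.im - y| < M * z.re}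

/-- `ψ ∈ L^∞(ℝ)` is the boundary function `y ↦ φ(iy)` of `φ ∈ H^∞(ℂ⁺)`: for almost every `y`, the
function `φ` has the nontangential limit `ψ y` at `iy`. -/
def IsBoundaryFunction (φ : HInfty) (ψ : LInfty) : Prop :=
  ∀ᵐ y : ℝ, ∀ M : ℝ, Tendsto (fun z : rightHalfPlane => (φ : rightHalfPlane →ᵇ ℂ) z)
    (comap ((↑) : rightHalfPlane → ℂ) (𝓝[approachRegion M y] (y * Complex.I))) (𝓝 (ψ y))

end HalfPlane

end

noncomputable section

namespace HalfPlane

open ProbabilityTheory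

/-! ### The standard Cauchy distribution -/

/-! For `z = x + iy` the Poisson integral `P_z φ = ∫ φ(y + x u) dμ(u)`, with `μ` the standard Cauchy
law, is a mean on `L^∞(ℝ)`, and on boundary functions of `H^∞` it is evaluation at `z`
(`exists_boundaryFunction`). Translating `φ` by `s` changes `P_z φ` by at most `‖φ‖ |s| / x`, so the
means `P_z` become translation invariant as `x → ∞`. Averaging over `s` against a density gives
topological invariance in the limit (`isTopologicallyInvariantMean_of_tendsto`). Banach-Alaoglu
provides a weak* limit of the `P_{z_α}` along an ultrafilter finer than the net; on `H^∞` it has to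
agree with `χ`.

Boundary functions come from Fatou's theorem, obtained by differentiating a primitive. A bounded
analytic function has a Lipschitz primitive, whose trace on the imaginary axis is differentiable
almost everywhere. The Poisson formula turns differentiability along the axis into convergence of
difference quotients from inside, and a Cauchy estimate passes from these to the derivative. -/

/-- The standard Cauchy distribution `π⁻¹ (1 + u²)⁻¹ du`. -/
abbrev stdCauchy : Measure ℝ := cauchyMeasure 0 1

theorem cauchyPDFReal_zero_one (u : ℝ) : cauchyPDFReal 0 1 u = Real.pi⁻¹ * (1 + u ^ 2)⁻¹ := by
  simp [cauchyPDFReal_def']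

theorem stdCauchy_eq_withDensity : stdCauchy = volume.withDensity (cauchyPDF 0 1) := by
  simp [cauchyMeasure]

theorem integral_stdCauchy {E : Type*} [NormedAddCommGroup E] [NormedSpace ℝ E] (f : ℝ → E) :
    ∫ u, f u ∂stdCauchy = ∫ u, (Real.pi⁻¹ * (1 + u ^ 2)⁻¹) • f u := by
  rw [stdCauchy_eq_withDensity, integral_withDensity_eq_integral_toReal_smul
    (measurable_cauchyPDF 0 1) (by simp [cauchyPDF])]
  refine integral_congr_ae (Eventually.of_forall fun u => ?_)
  simp only [cauchyPDF, cauchyPDFReal_zero_one]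
  rw [ENNReal.toReal_ofReal (by positivity)]

theorem stdCauchy_absolutelyContinuous : stdCauchy ≪ volume := by
  rw [stdCauchy_eq_withDensity]
  exact withDensity_absolutelyContinuous _ _

theorem quasiMeasurePreserving_affine_volume {x : ℝ} (hx : x ≠ 0) (y : ℝ) :
    Measure.QuasiMeasurePreserving (fun u => y + x * u) volume volume := by
  have h : Measure.QuasiMeasurePreserving (fun u : ℝ => x * u) volume volume := by
    refine ⟨by fun_prop, ?_⟩
    rw [Real.map_volume_mul_left hx]
    exact Measure.smul_absolutelyContinuous
  exact (measurePreserving_add_left volume y).quasiMeasurePreserving.comp h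

theorem quasiMeasurePreserving_affine {x : ℝ} (hx : 0 < x) (y : ℝ) :
    Measure.QuasiMeasurePreserving (fun u => y + x * u) stdCauchy volume :=
  (quasiMeasurePreserving_affine_volume hx.ne' y).mono_left stdCauchy_absolutelyContinuous

/-! ### The mean value property on the half plane -/

/-- The Cayley transform `w ↦ (1 - w) / (1 + w)`, mapping the unit disk onto the right half
plane. -/
def cayley (w : ℂ) : ℂ := (1 - w) / (1 + w)

theorem one_add_ne_zero_of_norm_lt_one {w : ℂ} (hw : ‖w‖ < 1) : 1 + w ≠ 0 := by
  intro h
  simp [show w = -1 from by linear_combination h] at hw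

theorem cayley_re_pos {w : ℂ} (hw : ‖w‖ < 1) : 0 < (cayley w).re := by
  have h1 : 0 < Complex.normSq (1 + w) :=
    Complex.normSq_pos.mpr (one_add_ne_zero_of_norm_lt_one hw)
  have h2 : w.re * w.re + w.im * w.im < 1 := by
    rw [← Complex.normSq_apply, Complex.normSq_eq_norm_sq]
    nlinarith [norm_nonneg w]
  rw [cayley, Complex.div_re, ← add_div]
  refine div_pos ?_ h1
  simp
  nlinarith

theorem differentiableOn_cayley : DifferentiableOn ℂ cayley (Metric.ball 0 1) := by
  intro w hw
  have : 1 + w ≠ 0 := one_add_ne_zero_of_norm_lt_one (by simpa using hw)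
  exact ((differentiableAt_id.const_sub 1).div (differentiableAt_id.const_add 1)
    this).differentiableWithinAt

/-- The boundary parametrization `(1 - iu) / (1 + iu)` of the unit circle. -/
theorem exp_neg_two_arctan (u : ℝ) :
    Complex.exp (((-2 * Real.arctan u : ℝ) : ℂ) * Complex.I) =
      (1 - u * Complex.I) / (1 + u * Complex.I) := by
  have hne : (1 + u * Complex.I : ℂ) ≠ 0 := by
    intro h; simpa using congrArg Complex.re h
  have hs : (0 : ℝ) < 1 + u ^ 2 := by positivity
  rw [Complex.exp_mul_I, ← Complex.ofReal_cos, ← Complex.ofReal_sin]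
  have hc : Real.cos (-2 * Real.arctan u) = (1 - u ^ 2) / (1 + u ^ 2) := by
    rw [neg_mul, Real.cos_neg, Real.cos_two_mul, Real.cos_sq_arctan]
    field_simp; ring
  have hsn : Real.sin (-2 * Real.arctan u) = -(2 * u) / (1 + u ^ 2) := by
    rw [neg_mul, Real.sin_neg, Real.sin_two_mul]
    have h := Real.cos_sq_arctan u
    have h2 : Real.sin (Real.arctan u) = u * Real.cos (Real.arctan u) := by
      rw [Real.sin_arctan, Real.cos_arctan]; ring
    rw [h2, show 2 * (u * Real.cos (Real.arctan u)) * Real.cos (Real.arctan u)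
      = 2 * u * Real.cos (Real.arctan u) ^ 2 by ring, h]
    field_simp
  rw [hc, hsn, eq_div_iff hne]
  have hs' : (1 + u ^ 2 : ℂ) ≠ 0 := by exact_mod_cast hs.ne'
  push_cast
  field_simp
  linear_combination (-(2 * u ^ 2 : ℂ)) * Complex.I_sq

/-- The substitution `θ = -2 arctan u` carries `μ` to normalized arc length; only the point `-1` of
the unit circle is missed. -/
theorem circleAverage_eq_integral_stdCauchy (f : ℂ → ℂ) (r : ℝ) :
    Real.circleAverage f 0 r =
      ∫ u, f (r * ((1 - u * Complex.I) / (1 + u * Complex.I))) ∂stdCauchy := by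
  have himg : (fun u => -2 * Real.arctan u) '' Set.univ = Set.Ioo (-Real.pi) Real.pi := by
    ext t
    have hr : t / (-2) ∈ Set.range Real.arctan ↔ t ∈ Set.Ioo (-Real.pi) Real.pi := by
      rw [Real.range_arctan, Set.mem_Ioo, Set.mem_Ioo]
      constructor <;> rintro ⟨h1, h2⟩ <;> constructor <;> linarith
    rw [← hr]
    constructor
    · rintro ⟨u, -, rfl⟩; exact ⟨u, by dsimp only; ring⟩
    · rintro ⟨u, hu⟩; exact ⟨u, trivial, by simp only [hu]; ring⟩
  have hcv := integral_image_eq_integral_abs_deriv_smul (s := Set.univ)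
    (f := fun u => -2 * Real.arctan u) (f' := fun u => -2 * (1 / (1 + u ^ 2)))
    MeasurableSet.univ
    (fun u _ => ((Real.hasDerivAt_arctan u).const_mul (-2)).hasDerivWithinAt)
    (fun a _ b _ h => Real.arctan_injective (by simpa using h))
    (fun t => f (circleMap 0 r t))
  rw [himg, setIntegral_univ, ← integral_Ioc_eq_integral_Ioo,
    ← intervalIntegral.integral_of_le (by linarith [Real.pi_pos])] at hcv
  have hper : ∫ t in (0 : ℝ)..2 * Real.pi, f (circleMap 0 r t) =
      ∫ t in (-Real.pi)..Real.pi, f (circleMap 0 r t) := by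
    have h : Function.Periodic (fun t => f (circleMap 0 r t)) (2 * Real.pi) := fun t => by
      simp only [periodic_circleMap 0 r t]
    have := h.intervalIntegral_add_eq 0 (-Real.pi)
    rw [zero_add] at this
    rw [this]; congr 1; ring
  rw [Real.circleAverage_def, hper, hcv, integral_stdCauchy, ← integral_smul]
  refine integral_congr_ae (Eventually.of_forall fun u => ?_)
  simp only [smul_smul, circleMap, exp_neg_two_arctan, zero_add]
  congr 1
  rw [abs_mul, abs_of_pos (show (0 : ℝ) < 1 / (1 + u ^ 2) by positivity)]
  norm_num
  field_simp

/-- The Cayley transform reduces this to the mean value property on circles of radius `r < 1`. As `r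
→ 1` the bound `C` dominates, and each boundary point is finite because `-1`, the preimage of
infinity, is never hit. -/
theorem mean_value_of_continuousOn {K : ℂ → ℂ} {C : ℝ}
    (hd : DifferentiableOn ℂ K rightHalfPlane) (hc : ContinuousOn K {z | 0 ≤ z.re})
    (hb : ∀ z ∈ rightHalfPlane, ‖K z‖ ≤ C) :
    K 1 = ∫ u : ℝ, K (u * Complex.I) ∂stdCauchy := by
  have hw (u : ℝ) : ‖(1 - u * Complex.I) / (1 + u * Complex.I)‖ = 1 := by
    rw [← exp_neg_two_arctan, Complex.norm_exp_ofReal_mul_I]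
  have hrw {r : ℝ} (h0 : 0 < r) (h1 : r < 1) (u : ℝ) :
      ‖(r : ℂ) * ((1 - u * Complex.I) / (1 + u * Complex.I))‖ < 1 := by
    rw [norm_mul, hw, mul_one, Complex.norm_real, Real.norm_eq_abs, abs_of_pos h0]; exact h1
  have hdk : DifferentiableOn ℂ (fun w => K (cayley w)) (Metric.ball 0 1) :=
    hd.comp differentiableOn_cayley fun w hw => cayley_re_pos (by simpa using hw)
  have hmv : ∀ᶠ r : ℝ in 𝓝[<] 1, K 1 =
      ∫ u : ℝ, K (cayley (r * ((1 - u * Complex.I) / (1 + u * Complex.I)))) ∂stdCauchy := by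
    filter_upwards [Ioo_mem_nhdsLT (zero_lt_one)] with r hr
    rw [← circleAverage_eq_integral_stdCauchy (fun w => K (cayley w)) r]
    have hsub : Metric.closedBall (0 : ℂ) |r| ⊆ Metric.ball 0 1 := by
      rw [abs_of_pos hr.1]; exact Metric.closedBall_subset_ball hr.2
    rw [DiffContOnCl.circleAverage ((hdk.mono hsub).diffContOnCl_ball subset_rfl)]
    simp [cayley]
  refine tendsto_nhds_unique (tendsto_const_nhds.congr' hmv) ?_
  refine tendsto_integral_filter_of_dominated_convergence (fun _ => C) ?_ ?_
    (integrable_const C) ?_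
  · filter_upwards [Ioo_mem_nhdsLT (zero_lt_one)] with r hr
    refine Continuous.aestronglyMeasurable ?_
    refine hdk.continuousOn.comp_continuous ?_ fun u => by simpa using hrw hr.1 hr.2 u
    refine continuous_const.mul (Continuous.div (by fun_prop) (by fun_prop) fun u h => ?_)
    simpa using congrArg Complex.re h
  · filter_upwards [Ioo_mem_nhdsLT (zero_lt_one)] with r hr
    exact Eventually.of_forall fun u => hb _ (cayley_re_pos (hrw hr.1 hr.2 u))
  · refine Eventually.of_forall fun u => ?_
    have hne : (1 + u * Complex.I : ℂ) ≠ 0 := by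
      intro h; simpa using congrArg Complex.re h
    have hsum : (1 : ℂ) + (1 - u * Complex.I) / (1 + u * Complex.I) ≠ 0 := by
      rw [show (1 : ℂ) + (1 - u * Complex.I) / (1 + u * Complex.I) = 2 / (1 + u * Complex.I) by
        field_simp; ring]
      exact div_ne_zero two_ne_zero hne
    have hlim : cayley ((1 - u * Complex.I) / (1 + u * Complex.I)) = u * Complex.I := by
      rw [cayley, div_eq_iff hsum]; field_simp; ring
    have hcont : ContinuousAt (fun r : ℝ =>
        cayley (r * ((1 - u * Complex.I) / (1 + u * Complex.I)))) 1 := by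
      unfold cayley
      refine ContinuousAt.div (by fun_prop) (by fun_prop) (by simpa using hsum)
    have ht := hcont.tendsto
    simp only [Complex.ofReal_one, one_mul, hlim] at ht
    have hK : Tendsto K (𝓝[{z : ℂ | 0 ≤ z.re}] (u * Complex.I)) (𝓝 (K (u * Complex.I))) :=
      hc (u * Complex.I) (by simp)
    refine hK.comp (tendsto_nhdsWithin_iff.mpr ⟨ht.mono_left nhdsWithin_le_nhds, ?_⟩)
    filter_upwards [Ioo_mem_nhdsLT (zero_lt_one)] with r hr
    exact (cayley_re_pos (hrw hr.1 hr.2 u)).le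

theorem isOpen_rightHalfPlane : IsOpen rightHalfPlane :=
  isOpen_lt continuous_const Complex.continuous_re

/-- The Poisson representation of a bounded analytic function on the right half plane by its
horizontal boundary limits. -/
theorem poisson_representation {K : ℂ → ℂ} {C : ℝ} {k : ℝ → ℂ}
    (hd : DifferentiableOn ℂ K rightHalfPlane) (hb : ∀ z ∈ rightHalfPlane, ‖K z‖ ≤ C)
    (hk : ∀ᵐ t : ℝ, Tendsto (fun ε : ℝ => K (ε + t * Complex.I)) (𝓝[>] 0) (𝓝 (k t)))
    {z : ℂ} (hz : 0 < z.re) :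
    K z = ∫ u, k (z.im + z.re * u) ∂stdCauchy := by
  -- Shifting by `ε` makes the function continuous up to the boundary; the map `w ↦ i y + x w` sends
  -- `1` to `z` and preserves the closed half plane.
  have hrep : ∀ᶠ ε : ℝ in 𝓝[>] 0, K (ε + z) =
      ∫ u : ℝ, K (ε + ((z.im + z.re * u : ℝ) : ℂ) * Complex.I) ∂stdCauchy := by
    filter_upwards [self_mem_nhdsWithin] with ε (hε : 0 < ε)
    have hm : ∀ w : ℂ, 0 ≤ w.re → (ε + (z.im * Complex.I + z.re * w) : ℂ) ∈ rightHalfPlane := by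
      intro w hw
      simp only [rightHalfPlane, Set.mem_ofPred_eq]
      simp
      positivity
    have hdiff : DifferentiableOn ℂ (fun w : ℂ => K (ε + (z.im * Complex.I + z.re * w)))
        {w | 0 ≤ w.re} := hd.comp (by fun_prop) hm
    have := mean_value_of_continuousOn (C := C) (hdiff.mono fun w (hw : 0 < w.re) => hw.le)
      hdiff.continuousOn fun w (hw : 0 < w.re) => hb _ (hm w hw.le)
    convert this using 3 with u
    · rw [mul_one, add_comm (_ * Complex.I), Complex.re_add_im]
    · push_cast; ring_nf
  have hKz : Tendsto (fun ε : ℝ => K (ε + z)) (𝓝[>] 0) (𝓝 (K z)) := by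
    have h1 : ContinuousAt K z := (hd.differentiableAt (isOpen_rightHalfPlane.mem_nhds hz)).continuousAt
    have h2 : Tendsto (fun ε : ℝ => (ε : ℂ) + z) (𝓝[>] 0) (𝓝 z) := by
      have : Continuous fun ε : ℝ => (ε : ℂ) + z := by fun_prop
      simpa using (this.tendsto 0).mono_left nhdsWithin_le_nhds
    exact h1.tendsto.comp h2
  refine tendsto_nhds_unique (hKz.congr' hrep) ?_
  refine tendsto_integral_filter_of_dominated_convergence (fun _ => C) ?_ ?_
    (integrable_const C) ?_
  · filter_upwards [self_mem_nhdsWithin] with ε (hε : 0 < ε)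
    refine Continuous.aestronglyMeasurable ?_
    refine hd.continuousOn.comp_continuous (by fun_prop) fun u => ?_
    simp only [rightHalfPlane, Set.mem_ofPred_eq]
    simpa using hε
  · filter_upwards [self_mem_nhdsWithin] with ε (hε : 0 < ε)
    refine Eventually.of_forall fun u => hb _ ?_
    simp only [rightHalfPlane, Set.mem_ofPred_eq]
    simpa using hε
  · exact (quasiMeasurePreserving_affine hz z.im).ae hk

/-! ### Fatou's theorem -/

theorem convex_rightHalfPlane : Convex ℝ rightHalfPlane :=
  convex_halfSpace_re_gt 0

theorem one_add_ne_zero_of_re_pos {z : ℂ} (hz : 0 < z.re) : 1 + z ≠ 0 := by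
  intro h
  have := congrArg Complex.re h
  simp at this
  linarith

theorem norm_cayley_lt_one {z : ℂ} (hz : 0 < z.re) : ‖cayley z‖ < 1 := by
  have h0 : 0 < ‖1 + z‖ := norm_pos_iff.mpr (one_add_ne_zero_of_re_pos hz)
  rw [cayley, norm_div, div_lt_one h0]
  refine lt_of_pow_lt_pow_left₀ 2 h0.le ?_
  rw [← Complex.normSq_eq_norm_sq, ← Complex.normSq_eq_norm_sq, Complex.normSq_apply,
    Complex.normSq_apply]
  simp
  nlinarith

theorem cayley_cayley {z : ℂ} (hz : 1 + z ≠ 0) : cayley (cayley z) = z := by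
  unfold cayley
  field_simp
  ring

theorem hasDerivAt_cayley {z : ℂ} (hz : 1 + z ≠ 0) : HasDerivAt cayley (-2 / (1 + z) ^ 2) z := by
  have := ((hasDerivAt_id z).const_sub 1).div ((hasDerivAt_id z).const_add 1) hz
  convert! this using 1
  simp
  ring

/-- The Cayley transform `c` is an involution. If `F` is a primitive of `(φ ∘ c) c'` on the disk,
then `F ∘ c` is a primitive of `φ`. -/
theorem exists_primitive_rightHalfPlane {φ : ℂ → ℂ} (hφ : DifferentiableOn ℂ φ rightHalfPlane) :
    ∃ G : ℂ → ℂ, ∀ z ∈ rightHalfPlane, HasDerivAt G (φ z) z := by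
  have hd : DifferentiableOn ℂ (fun w => φ (cayley w) * (-2 / (1 + w) ^ 2)) (Metric.ball 0 1) := by
    refine (hφ.comp differentiableOn_cayley fun w hw => cayley_re_pos (by simpa using hw)).mul ?_
    intro w hw
    have : 1 + w ≠ 0 := one_add_ne_zero_of_norm_lt_one (by simpa using hw)
    refine DifferentiableAt.differentiableWithinAt (𝕜 := ℂ) ?_
    exact DifferentiableAt.div (by fun_prop) (by fun_prop) (pow_ne_zero 2 this)
  obtain ⟨F, hF⟩ := hd.isExactOn_ball
  refine ⟨fun z => F (cayley z), fun z (hz : 0 < z.re) => ?_⟩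
  have h1 := one_add_ne_zero_of_re_pos hz
  have h2 : 1 + cayley z ≠ 0 := one_add_ne_zero_of_norm_lt_one (norm_cayley_lt_one hz)
  have h3 : 1 + cayley z = 2 / (1 + z) := by unfold cayley; field_simp; ring
  have := (hF (cayley z) (by simpa using norm_cayley_lt_one hz)).comp z (hasDerivAt_cayley h1)
  refine this.congr_deriv ?_
  simp only [cayley_cayley h1, h3]
  field_simp

/-- A bounded analytic function on the right half plane has a primitive that extends to a
Lipschitz function on `ℂ`. -/
theorem exists_lipschitz_primitive {φ : ℂ → ℂ} {C : ℝ}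
    (hφ : DifferentiableOn ℂ φ rightHalfPlane) (hb : ∀ z ∈ rightHalfPlane, ‖φ z‖ ≤ C) :
    ∃ (G : ℂ → ℂ) (L : NNReal), LipschitzWith L G ∧
      ∀ z ∈ rightHalfPlane, HasDerivAt G (φ z) z := by
  obtain ⟨G, hG⟩ := exists_primitive_rightHalfPlane hφ
  have hL : LipschitzOnWith C.toNNReal G rightHalfPlane :=
    convex_rightHalfPlane.lipschitzOnWith_of_nnnorm_hasDerivWithin_le
      (fun z hz => (hG z hz).hasDerivWithinAt) fun z hz => by
        rw [← NNReal.coe_le_coe, coe_nnnorm]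
        exact (hb z hz).trans (Real.le_coe_toNNReal C)
  -- The extension supplies boundary values on the axis and leaves derivatives in the open half
  -- plane unchanged.
  obtain ⟨G', hG', heq⟩ := hL.extend_finite_dimension
  refine ⟨G', _, hG', fun z hz => (hG z hz).congr_of_eventuallyEq ?_⟩
  filter_upwards [isOpen_rightHalfPlane.mem_nhds hz] with w hw using (heq hw).symm

theorem lipschitzWith_comp_mul_I {G : ℂ → ℂ} {L : NNReal} (hL : LipschitzWith L G) :
    LipschitzWith L fun t : ℝ => G (t * Complex.I) := by
  refine LipschitzWith.of_dist_le_mul fun s t => (hL.dist_le_mul _ _).trans_eq ?_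
  rw [Complex.dist_eq, ← sub_mul, norm_mul, Complex.norm_I, mul_one, ← Complex.ofReal_sub,
    Complex.norm_real, Real.dist_eq, Real.norm_eq_abs]

/-- The difference quotient is analytic and bounded by `L`, hence the Poisson integral of its
boundary values. These become continuous once the derivative is put in at `t₀`, so the Poisson
integral converges there, even without an approach region. -/
theorem tendsto_slope_boundary {φ G : ℂ → ℂ} {L : NNReal} (hL : LipschitzWith L G)
    (hG : ∀ z ∈ rightHalfPlane, HasDerivAt G (φ z) z) {t₀ : ℝ}
    (hd : DifferentiableAt ℝ (fun t : ℝ => G (t * Complex.I)) t₀) :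
    Tendsto (fun w => (G w - G (t₀ * Complex.I)) / (w - t₀ * Complex.I))
      (𝓝[rightHalfPlane] (t₀ * Complex.I))
      (𝓝 (-Complex.I * deriv (fun t : ℝ => G (t * Complex.I)) t₀)) := by
  set g : ℝ → ℂ := fun t => G (t * Complex.I) with hg
  -- The factor `-I` is `1 / I`: on the axis the denominator is `I (t - t₀)`.
  set k : ℝ → ℂ := fun t => -Complex.I * dslope g t₀ t with hk
  have hgL : LipschitzWith L g := lipschitzWith_comp_mul_I hL
  have hgc : Continuous g := hgL.continuous
  have hkc : Continuous k := by
    refine continuous_const.mul (continuous_iff_continuousAt.mpr fun t => ?_)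
    rcases eq_or_ne t t₀ with rfl | ht
    · exact continuousAt_dslope_same.mpr hd
    · exact (continuousAt_dslope_of_ne ht).mpr hgc.continuousAt
  have hkb : ∀ t, ‖k t‖ ≤ L := by
    intro t
    rw [hk, norm_mul, norm_neg, Complex.norm_I, one_mul]
    rcases eq_or_ne t t₀ with rfl | ht
    · rw [dslope_same]; exact norm_deriv_le_of_lipschitz hgL
    · rw [dslope_of_ne _ ht, slope_def_module, norm_smul, norm_inv, ← dist_eq_norm,
        ← dist_eq_norm, inv_mul_le_iff₀ (dist_pos.mpr ht), mul_comm]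
      exact hgL.dist_le_mul _ _
  have hne : ∀ w ∈ rightHalfPlane, w - t₀ * Complex.I ≠ 0 := by
    intro w (hw : 0 < w.re) h
    have := congrArg Complex.re h
    simp at this
    exact hw.ne' this
  have hrep : ∀ w ∈ rightHalfPlane, (G w - G (t₀ * Complex.I)) / (w - t₀ * Complex.I) =
      ∫ u, k (w.im + w.re * u) ∂stdCauchy := by
    intro w hw
    refine poisson_representation (C := L)
      (K := fun w => (G w - G (t₀ * Complex.I)) / (w - t₀ * Complex.I)) ?_ ?_ ?_ hw
    · intro z hz
      exact (((hG z hz).differentiableAt.sub_const _).div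
        (differentiableAt_id.sub_const _) (hne z hz)).differentiableWithinAt
    · intro z hz
      rw [norm_div, div_le_iff₀ (norm_pos_iff.mpr (hne z hz)), ← dist_eq_norm, ← dist_eq_norm]
      exact hL.dist_le_mul _ _
    · have : ∀ᵐ t : ℝ, t ≠ t₀ := by simp [ae_iff]
      filter_upwards [this] with t ht
      have ht' : (t * Complex.I - t₀ * Complex.I : ℂ) ≠ 0 := by
        rw [← sub_mul]
        exact mul_ne_zero (by exact_mod_cast sub_ne_zero.mpr ht) Complex.I_ne_zero
      have hval : k t = (G ((0 : ℝ) + t * Complex.I) - G (t₀ * Complex.I)) /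
          ((0 : ℝ) + t * Complex.I - t₀ * Complex.I) := by
        have h3 : (t - t₀ : ℂ) ≠ 0 := by exact_mod_cast sub_ne_zero.mpr ht
        simp only [hk, hg, dslope_of_ne _ ht, slope_def_module, Complex.real_smul,
          Complex.ofReal_zero, zero_add, ← sub_mul]
        push_cast
        field_simp
        rw [Complex.I_sq]
        ring
      rw [hval]
      have hc : ContinuousAt (fun ε : ℝ => (G (ε + t * Complex.I) - G (t₀ * Complex.I)) /
          (ε + t * Complex.I - t₀ * Complex.I)) 0 := by
        refine ContinuousAt.div ?_ (by fun_prop) (by simpa using ht')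
        have := hL.continuous
        fun_prop
      exact hc.tendsto.mono_left nhdsWithin_le_nhds
  have hlim : Tendsto (fun w : ℂ => ∫ u, k (w.im + w.re * u) ∂stdCauchy)
      (𝓝[rightHalfPlane] (t₀ * Complex.I)) (𝓝 (∫ _, k t₀ ∂stdCauchy)) := by
    refine tendsto_integral_filter_of_dominated_convergence (fun _ => (L : ℝ))
      (Eventually.of_forall fun w => ?_) (Eventually.of_forall fun w =>
        Eventually.of_forall fun u => hkb _) (integrable_const _)
      (Eventually.of_forall fun u => ?_)
    · exact Continuous.aestronglyMeasurable (by fun_prop)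
    · have : Continuous fun w : ℂ => k (w.im + w.re * u) := by fun_prop
      simpa using (this.tendsto (t₀ * Complex.I)).mono_left nhdsWithin_le_nhds
  have hk₀ : ∫ _, k t₀ ∂stdCauchy = -Complex.I * deriv g t₀ := by simp [hk]
  rw [hk₀] at hlim
  refine hlim.congr' ?_
  filter_upwards [self_mem_nhdsWithin] with w hw using (hrep w hw).symm

/-- If the primitive of `φ` is differentiable along the boundary at a point, then `φ` has a
nontangential limit there. -/
theorem tendsto_nontangential {φ G : ℂ → ℂ} {L : NNReal} (hL : LipschitzWith L G)
    (hG : ∀ z ∈ rightHalfPlane, HasDerivAt G (φ z) z) {t₀ : ℝ}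
    (hd : DifferentiableAt ℝ (fun t : ℝ => G (t * Complex.I)) t₀) (M : ℝ) :
    Tendsto φ (𝓝[approachRegion M t₀] (t₀ * Complex.I))
      (𝓝 (-Complex.I * deriv (fun t : ℝ => G (t * Complex.I)) t₀)) := by
  have hs := tendsto_slope_boundary hL hG hd
  set a := -Complex.I * deriv (fun t : ℝ => G (t * Complex.I)) t₀
  rcases le_or_gt M 0 with hM | hM
  · have : approachRegion M t₀ = ∅ := by
      refine Set.eq_empty_of_forall_notMem fun z hz => ?_
      have h1 := abs_nonneg (z.im - t₀)
      have h2 := mul_nonpos_of_nonpos_of_nonneg hM hz.1.le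
      linarith [hz.2]
    simp [this]
  rw [Metric.tendsto_nhdsWithin_nhds] at hs ⊢
  intro ε hε
  -- The Cauchy estimate below loses a factor `2 (M + 2)`; the extra `1` makes the final inequality
  -- strict.
  obtain ⟨δ, hδ, hH⟩ := hs (ε / (2 * (M + 2) + 1)) (by positivity)
  set η := ε / (2 * (M + 2) + 1) with hη
  have hη0 : 0 < η := by positivity
  -- The sphere of radius `z.re / 2` about `z` stays within `(M + 2) z.re` of the boundary point,
  -- and `z.re` is at most the distance of `z` from it.
  refine ⟨δ / (M + 2), by positivity, fun {z} hz hzd => ?_⟩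
  have hr : 0 < z.re := hz.1
  have hre : z.re ≤ dist z (t₀ * Complex.I) := by
    rw [Complex.dist_eq]
    refine le_trans (le_abs_self _) ?_
    simpa using Complex.abs_re_le_norm (z - t₀ * Complex.I)
  have hdz : dist z (t₀ * Complex.I) ≤ (1 + M) * z.re := by
    rw [Complex.dist_eq]
    refine (Complex.norm_le_abs_re_add_abs_im _).trans ?_
    have := hz.2
    simp [abs_of_pos hr]
    linarith
  have hball : ∀ w ∈ Metric.closedBall z (z.re / 2), w ∈ rightHalfPlane := by
    intro w hw
    rw [Metric.mem_closedBall, Complex.dist_eq] at hw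
    have h1 := (abs_le.mp ((Complex.abs_re_le_norm (w - z)).trans hw)).1
    simp only [Complex.sub_re] at h1
    change 0 < w.re
    linarith
  set D : ℂ → ℂ := fun w => G w - G (t₀ * Complex.I) - a * (w - t₀ * Complex.I) with hD
  have hDd : ∀ w ∈ rightHalfPlane, HasDerivAt D (φ w - a) w := by
    intro w hw
    have := ((hG w hw).sub_const (G (t₀ * Complex.I))).sub
      (((hasDerivAt_id w).sub_const (t₀ * Complex.I : ℂ)).const_mul a)
    exact this.congr_deriv (by rw [mul_one])
  -- `D` is the error of the linear approximation and `D' = φ - a`. In the approach region the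
  -- radius is comparable to the distance from the boundary point, so `D = o(distance)` gives `D' =
  -- o(1)`.
  have hest : ‖deriv D z‖ ≤ (η * ((M + 2) * z.re)) / (z.re / 2) := by
    refine Complex.norm_deriv_le_of_forall_mem_sphere_norm_le (by positivity) ?_ ?_
    · refine DifferentiableOn.diffContOnCl_ball (U := Metric.closedBall z (z.re / 2)) ?_ subset_rfl
      exact fun w hw => (hDd w (hball w hw)).differentiableAt.differentiableWithinAt
    · intro w hw
      have hwR := hball w (Metric.sphere_subset_closedBall hw)
      have hwz : dist w (t₀ * Complex.I) ≤ (M + 2) * z.re := by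
        have := dist_triangle w z (t₀ * Complex.I)
        rw [Metric.mem_sphere.mp hw] at this
        linarith
      have hwd : dist w (t₀ * Complex.I) < δ := by
        refine hwz.trans_lt ?_
        rw [lt_div_iff₀ (by positivity)] at hzd
        nlinarith
      have hne : w - t₀ * Complex.I ≠ 0 := by
        intro h
        have := congrArg Complex.re h
        simp at this
        exact (show 0 < w.re from hwR).ne' this
      have hlt := hH hwR hwd
      have hfac : D w = ((G w - G (t₀ * Complex.I)) / (w - t₀ * Complex.I) - a) *
          (w - t₀ * Complex.I) := by
        rw [hD, sub_mul, div_mul_cancel₀ _ hne]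
      rw [hfac, norm_mul, ← Complex.dist_eq, ← Complex.dist_eq]
      exact mul_le_mul hlt.le hwz dist_nonneg hη0.le
  rw [(hDd z hr).deriv] at hest
  rw [Complex.dist_eq]
  refine hest.trans_lt ?_
  have h1 : η * ((M + 2) * z.re) / (z.re / 2) = η * (2 * (M + 2)) := by field_simp
  have h2 : ε = η * (2 * (M + 2) + 1) := by rw [hη]; field_simp
  rw [h1, h2]
  nlinarith

/-- **Fatou's theorem** for the right half plane: a bounded analytic function has nontangential
limits at almost every point of the imaginary axis. -/
theorem exists_nontangential_limit {φ : ℂ → ℂ} {C : ℝ}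
    (hφ : DifferentiableOn ℂ φ rightHalfPlane) (hb : ∀ z ∈ rightHalfPlane, ‖φ z‖ ≤ C) :
    ∃ k : ℝ → ℂ, ∀ᵐ t : ℝ, ∀ M : ℝ,
      Tendsto φ (𝓝[approachRegion M t] (t * Complex.I)) (𝓝 (k t)) := by
  obtain ⟨G, L, hL, hG⟩ := exists_lipschitz_primitive hφ hb
  have hgL := lipschitzWith_comp_mul_I hL
  exact ⟨_, hgL.ae_differentiableAt_real.mono fun t ht M => tendsto_nontangential hL hG ht M⟩

theorem tendsto_horizontal_approachRegion (t : ℝ) :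
    Tendsto (fun ε : ℝ => (ε + t * Complex.I : ℂ)) (𝓝[>] 0)
      (𝓝[approachRegion 1 t] (t * Complex.I)) := by
  refine tendsto_nhdsWithin_iff.mpr ⟨?_, ?_⟩
  · have : Continuous fun ε : ℝ => (ε + t * Complex.I : ℂ) := by fun_prop
    simpa using (this.tendsto 0).mono_left nhdsWithin_le_nhds
  · filter_upwards [self_mem_nhdsWithin] with ε (hε : 0 < ε)
    simp [approachRegion, hε]

/-- Every `φ ∈ H^∞(ℂ⁺)` has a boundary function in `L^∞(ℝ)`, of which it is the Poisson
integral. -/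
theorem exists_boundaryFunction (φ : HInfty) :
    ∃ ψ : LInfty, IsBoundaryFunction φ ψ ∧ ∀ z : rightHalfPlane,
      (φ : rightHalfPlane →ᵇ ℂ) z = ∫ u, ψ ((z : ℂ).im + (z : ℂ).re * u) ∂stdCauchy := by
  obtain ⟨g, hg, hφ⟩ := φ.2
  set C := ‖(φ : rightHalfPlane →ᵇ ℂ)‖
  have hb : ∀ z ∈ rightHalfPlane, ‖g z‖ ≤ C := fun z hz => by
    rw [← hφ ⟨z, hz⟩]; exact BoundedContinuousFunction.norm_coe_le_norm _ _
  obtain ⟨k, hk⟩ := exists_nontangential_limit hg hb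
  have hrad : ∀ᵐ t : ℝ, Tendsto (fun ε : ℝ => g (ε + t * Complex.I)) (𝓝[>] 0) (𝓝 (k t)) :=
    hk.mono fun t ht => (ht 1).comp (tendsto_horizontal_approachRegion t)
  have hmem (ε : ℝ) (hε : 0 < ε) (t : ℝ) : (ε + t * Complex.I : ℂ) ∈ rightHalfPlane := by
    change 0 < (ε + t * Complex.I : ℂ).re
    simpa using hε
  -- `k` is an a.e. limit of the continuous functions on the lines `Re z = 1 / (n + 1)`.
  have hmeas : AEStronglyMeasurable k volume := by
    refine aestronglyMeasurable_of_tendsto_ae atTop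
      (f := fun (n : ℕ) (t : ℝ) => g (((1 / ((n : ℝ) + 1) : ℝ) : ℂ) + t * Complex.I))
      (fun n => ?_) ?_
    · refine (hg.continuousOn.comp_continuous (by fun_prop) fun t =>
        hmem _ (by positivity) t).aestronglyMeasurable
    · have : Tendsto (fun n : ℕ => 1 / ((n : ℝ) + 1)) atTop (𝓝[>] 0) :=
        tendsto_nhdsWithin_iff.mpr ⟨tendsto_one_div_add_atTop_nhds_zero_nat,
          Eventually.of_forall fun n => by simp only [Set.mem_Ioi]; positivity⟩
      exact hrad.mono fun t ht => ht.comp this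
  have hkb : ∀ᵐ t : ℝ, ‖k t‖ ≤ C := hrad.mono fun t ht => by
    refine le_of_tendsto ht.norm ?_
    filter_upwards [self_mem_nhdsWithin] with ε hε using hb _ (hmem ε hε t)
  have hLp : MemLp k ∞ volume := memLp_top_of_bound hmeas C hkb
  have hae := hLp.coeFn_toLp
  refine ⟨hLp.toLp k, ?_, fun z => ?_⟩
  · filter_upwards [hk, hae] with t ht hte M
    rw [hte]
    exact ((ht M).comp tendsto_comap).congr fun z => (hφ z).symm
  · rw [hφ z]
    refine poisson_representation hg hb ?_ z.2
    filter_upwards [hrad, hae] with t ht hte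
    rwa [hte]

/-! ### Poisson functionals on `L^∞(ℝ)` -/

theorem ae_norm_le_norm (φ : LInfty) : ∀ᵐ t, ‖φ t‖ ≤ ‖φ‖ := by
  filter_upwards [ae_le_eLpNormEssSup (f := φ) (μ := volume)] with y hy
  rw [← eLpNorm_exponent_top, ← Lp.enorm_def] at hy
  exact enorm_le_iff_norm_le.mp hy

theorem ae_norm_comp_affine_le (φ : LInfty) (y : ℝ) {x : ℝ} (hx : 0 < x) :
    ∀ᵐ u ∂stdCauchy, ‖φ (y + x * u)‖ ≤ ‖φ‖ :=
  (quasiMeasurePreserving_affine hx y).ae (ae_norm_le_norm φ)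

theorem integrable_comp_affine (φ : LInfty) (y : ℝ) {x : ℝ} (hx : 0 < x) :
    Integrable (fun u => φ (y + x * u)) stdCauchy :=
  (integrable_const ‖φ‖).mono'
    ((Lp.aestronglyMeasurable φ).comp_quasiMeasurePreserving (quasiMeasurePreserving_affine hx y))
    (ae_norm_comp_affine_le φ y hx)

theorem integral_comp_affine_congr {φ ψ : ℝ → ℂ} (h : φ =ᵐ[volume] ψ) (y : ℝ) {x : ℝ}
    (hx : 0 < x) : ∫ u, φ (y + x * u) ∂stdCauchy = ∫ u, ψ (y + x * u) ∂stdCauchy :=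
  integral_congr_ae ((quasiMeasurePreserving_affine hx y).ae h)

/-- Integration against the Poisson kernel of the point `z`. -/
def poissonFunctional (z : rightHalfPlane) : StrongDual ℂ LInfty :=
  LinearMap.mkContinuous
    { toFun := fun φ => ∫ u, φ ((z : ℂ).im + (z : ℂ).re * u) ∂stdCauchy
      map_add' := fun φ ψ => by
        rw [integral_comp_affine_congr (Lp.coeFn_add φ ψ) _ z.2]
        exact integral_add (integrable_comp_affine φ _ z.2) (integrable_comp_affine ψ _ z.2)
      map_smul' := fun c φ => by
        rw [integral_comp_affine_congr (Lp.coeFn_smul c φ) _ z.2]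
        exact integral_smul c _ }
    1 fun φ => by
      refine (norm_integral_le_of_norm_le (integrable_const ‖φ‖)
        (ae_norm_comp_affine_le φ _ z.2)).trans ?_
      simp

theorem poissonFunctional_apply (z : rightHalfPlane) (φ : LInfty) :
    poissonFunctional z φ = ∫ u, φ ((z : ℂ).im + (z : ℂ).re * u) ∂stdCauchy := rfl

theorem norm_poissonFunctional_le (z : rightHalfPlane) : ‖poissonFunctional z‖ ≤ 1 :=
  LinearMap.mkContinuous_norm_le _ zero_le_one _

theorem isMean_poissonFunctional (z : rightHalfPlane) : IsMean (poissonFunctional z) where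
  nonneg φ hφ := by
    rw [poissonFunctional_apply]
    exact integral_nonneg_of_ae ((quasiMeasurePreserving_affine z.2 _).ae hφ)
  map_one := by
    rw [poissonFunctional_apply, oneLInfty,
      integral_comp_affine_congr (MemLp.coeFn_toLp _) _ z.2]
    simp

/-- Over a common denominator this is `|a + b| ≤ ((1 + a²) + (1 + b²)) / 2` with `a = u + h`, `b =
u`. The right side integrates exactly, so the normalized kernel moves by at most `|h|` in `L^1`. -/
theorem abs_inv_one_add_sq_sub_le (u h : ℝ) :
    |(1 + (u + h) ^ 2)⁻¹ - (1 + u ^ 2)⁻¹| ≤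
      |h| / 2 * ((1 + (u + h) ^ 2)⁻¹ + (1 + u ^ 2)⁻¹) := by
  have h1 : (0 : ℝ) < 1 + (u + h) ^ 2 := by positivity
  have h2 : (0 : ℝ) < 1 + u ^ 2 := by positivity
  have e1 : (1 + (u + h) ^ 2)⁻¹ - (1 + u ^ 2)⁻¹ =
      (-h * (2 * u + h)) / ((1 + (u + h) ^ 2) * (1 + u ^ 2)) := by field_simp; ring
  have e2 : |h| / 2 * ((1 + (u + h) ^ 2)⁻¹ + (1 + u ^ 2)⁻¹) =
      (|h| * ((1 + (u + h) ^ 2 + (1 + u ^ 2)) / 2)) / ((1 + (u + h) ^ 2) * (1 + u ^ 2)) := by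
    field_simp; ring
  rw [e1, e2, abs_div, abs_of_pos (mul_pos h1 h2), abs_mul, abs_neg]
  gcongr
  rw [abs_le]
  constructor <;> nlinarith [sq_nonneg (u + h - 1), sq_nonneg (u + h + 1), sq_nonneg (u - 1),
    sq_nonneg (u + 1)]

/-- A translation by `s` changes the Poisson integral at height `x` by at most `‖φ‖ |s| / x`. -/
theorem norm_integral_translate_sub_le (φ : LInfty) (y s : ℝ) {x : ℝ} (hx : 0 < x) :
    ‖∫ u, φ (y + x * u - s) ∂stdCauchy - ∫ u, φ (y + x * u) ∂stdCauchy‖ ≤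
      ‖φ‖ * (|s| / x) := by
  set p : ℝ → ℝ := fun u => Real.pi⁻¹ * (1 + u ^ 2)⁻¹ with hp
  have hpi : Integrable p := integrable_inv_one_add_sq.const_mul _
  have hp1 : ∫ u, p u = 1 := by
    rw [integral_const_mul, integral_univ_inv_one_add_sq, inv_mul_cancel₀ Real.pi_ne_zero]
  have hqmp := quasiMeasurePreserving_affine_volume hx.ne' y
  have hφm := (Lp.aestronglyMeasurable φ).comp_quasiMeasurePreserving hqmp
  have hφb := hqmp.ae (ae_norm_le_norm φ)
  set h := s / x with hh
  -- Substituting `u + h` for `u`, with `h = s / x`, moves the translation from `φ`, which is only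
  -- measurable, to the smooth kernel.
  have htrans : ∫ u, φ (y + x * u - s) ∂stdCauchy = ∫ u, p (u + h) • φ (y + x * u) := by
    rw [integral_stdCauchy, ← integral_add_right_eq_self _ h]
    refine integral_congr_ae (Eventually.of_forall fun u => ?_)
    have : y + x * (u + h) - s = y + x * u := by rw [hh]; field_simp; ring
    simp only [this, hp]
  have hi {q : ℝ → ℝ} (hq : Integrable q) : Integrable fun u => q u • φ (y + x * u) :=
    hq.smul_bdd _ hφm hφb
  have hph : Integrable fun u => p (u + h) := hpi.comp_add_right h
  rw [htrans, integral_stdCauchy, ← integral_sub (hi hph) (hi hpi)]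
  have hbd : Integrable fun u => |h| / 2 * (p (u + h) + p u) * ‖φ‖ :=
    ((hph.add hpi).const_mul _).mul_const _
  refine (norm_integral_le_of_norm_le hbd ?_).trans_eq ?_
  · filter_upwards [hφb] with u hu
    rw [← sub_smul, norm_smul]
    refine mul_le_mul ?_ hu (norm_nonneg _) (by positivity)
    rw [Real.norm_eq_abs]
    simp only [hp]
    rw [← mul_sub, ← mul_add, abs_mul, abs_of_pos (inv_pos.mpr Real.pi_pos), mul_left_comm]
    exact mul_le_mul_of_nonneg_left (abs_inv_one_add_sq_sub_le u h)
      (inv_pos.mpr Real.pi_pos).le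
  · rw [integral_mul_const, integral_const_mul, integral_add hph hpi,
      integral_add_right_eq_self p h, hp1, hh, abs_div, abs_of_pos hx]
    ring

/-- Fubini; this reduces invariance under convolution to invariance under translation. -/
theorem poissonFunctional_conv (z : rightHalfPlane) (f : Lp ℝ 1 (volume : Measure ℝ))
    (φ : LInfty) : poissonFunctional z (conv f φ) =
      ∫ s, f s • ∫ u, φ ((z : ℂ).im + (z : ℂ).re * u - s) ∂stdCauchy := by
  set x := (z : ℂ).re
  set y := (z : ℂ).im
  have hx : 0 < x := z.2
  have hf : Integrable (f : ℝ → ℝ) volume := L1.integrable_coeFn f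
  have hm : AEStronglyMeasurable
      (fun q : ℝ × ℝ => f q.2 • φ (y + x * q.1 - q.2)) (stdCauchy.prod volume) :=
    (AEStronglyMeasurable.convolution_integrand (ContinuousLinearMap.lsmul ℝ ℝ) (μ := volume)
      (ν := volume) hf.aestronglyMeasurable
      (Lp.aestronglyMeasurable φ)).comp_quasiMeasurePreserving
      (QuasiMeasurePreserving.prodMap (quasiMeasurePreserving_affine hx y)
        (Measure.QuasiMeasurePreserving.id volume))
  have hb (s : ℝ) : ∀ᵐ u ∂stdCauchy, ‖f s • φ (y + x * u - s)‖ ≤ ‖f s‖ * ‖φ‖ := by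
    have h := (quasiMeasurePreserving_affine hx (y - s)).ae (ae_norm_le_norm φ)
    filter_upwards [h] with u hu
    rw [norm_smul, show y + x * u - s = y - s + x * u by ring]
    gcongr
  have hint : Integrable (fun q : ℝ × ℝ => f q.2 • φ (y + x * q.1 - q.2))
      (stdCauchy.prod volume) := by
    rw [integrable_prod_iff' hm]
    constructor
    · filter_upwards [hm.prodMk_right] with s hs
      exact (integrable_const _).mono' hs (hb s)
    · refine (hf.norm.mul_const ‖φ‖).mono' hm.norm.prod_swap.integral_prod_right'
        (Eventually.of_forall fun s => ?_)
      refine (norm_integral_le_of_norm_le (integrable_const (‖f s‖ * ‖φ‖)) ?_).trans_eq (by simp)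
      filter_upwards [hb s] with u hu using by simpa using hu
  rw [poissonFunctional_apply, conv, integral_comp_affine_congr (MemLp.coeFn_toLp _) _ z.2]
  simp only [convolution_def, ContinuousLinearMap.lsmul_apply]
  rw [integral_integral_swap hint]
  exact integral_congr_ae (Eventually.of_forall fun s => integral_smul _ _)

/-- Since `∫ f = 1`, the difference is an `f`-average of translation errors. The cap `2 ‖φ‖` is
needed because `|s| f(s)` need not be integrable. -/
theorem norm_poissonFunctional_conv_sub_le (z : rightHalfPlane) {f : Lp ℝ 1 (volume : Measure ℝ)}
    (hf : f ∈ densities) (φ : LInfty) :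
    ‖poissonFunctional z (conv f φ) - poissonFunctional z φ‖ ≤
      ∫ s, ‖f s‖ * min (2 * ‖φ‖) (‖φ‖ * (|s| / (z : ℂ).re)) := by
  have hfi : Integrable (f : ℝ → ℝ) volume := L1.integrable_coeFn f
  set J : ℝ → ℂ := fun s => ∫ u, φ ((z : ℂ).im + (z : ℂ).re * u - s) ∂stdCauchy with hJ
  have hbound (s : ℝ) : ‖J s - poissonFunctional z φ‖ ≤
      min (2 * ‖φ‖) (‖φ‖ * (|s| / (z : ℂ).re)) := by
    refine le_min ?_ (norm_integral_translate_sub_le φ _ s z.2)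
    refine (norm_sub_le _ _).trans ?_
    rw [two_mul]
    refine add_le_add ?_ ?_
    · refine (norm_integral_le_of_norm_le (integrable_const ‖φ‖) ?_).trans_eq (by simp)
      filter_upwards [ae_norm_comp_affine_le φ ((z : ℂ).im - s) z.2] with u hu
      rwa [show (z : ℂ).im + (z : ℂ).re * u - s = (z : ℂ).im - s + (z : ℂ).re * u by ring]
    · simpa using (poissonFunctional z).le_of_opNorm_le (norm_poissonFunctional_le z) φ
  -- Continuity serves only to make `s ↦ f s • J s` measurable; the translation bound gives the
  -- Lipschitz constant `‖φ‖ / x`.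
  have hJc : Continuous J := by
    refine (LipschitzWith.of_dist_le_mul (K := (‖φ‖ / (z : ℂ).re).toNNReal)
      fun s t => ?_).continuous
    have h := norm_integral_translate_sub_le φ ((z : ℂ).im - t) (s - t) z.2
    have hz : (0 : ℝ) ≤ ‖φ‖ / (z : ℂ).re := div_nonneg (norm_nonneg _) z.2.le
    rw [dist_eq_norm, Real.dist_eq, Real.coe_toNNReal _ hz]
    convert! h using 1
    · simp only [hJ]
      congr 4 <;> ext u <;> congr 1 <;> ring
    · ring
  have hmin : Continuous fun s : ℝ => min (2 * ‖φ‖) (‖φ‖ * (|s| / (z : ℂ).re)) := by fun_prop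
  have hbd : Integrable fun s => ‖f s‖ * min (2 * ‖φ‖) (‖φ‖ * (|s| / (z : ℂ).re)) := by
    refine hfi.norm.mul_bdd (c := 2 * ‖φ‖) hmin.aestronglyMeasurable
      (Eventually.of_forall fun s => ?_)
    rw [Real.norm_of_nonneg ((norm_nonneg _).trans (hbound s))]
    exact min_le_left _ _
  have h1 : Integrable fun s => f s • J s := by
    refine hfi.smul_bdd ‖φ‖ hJc.aestronglyMeasurable (Eventually.of_forall fun s => ?_)
    refine (norm_integral_le_of_norm_le (integrable_const ‖φ‖) ?_).trans_eq (by simp)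
    filter_upwards [ae_norm_comp_affine_le φ ((z : ℂ).im - s) z.2] with u hu
    rwa [show (z : ℂ).im + (z : ℂ).re * u - s = (z : ℂ).im - s + (z : ℂ).re * u by ring]
  have h2 : poissonFunctional z φ = ∫ s, f s • poissonFunctional z φ := by
    rw [integral_smul_const, hf.2, one_smul]
  rw [poissonFunctional_conv, h2, ← integral_sub h1 (hfi.smul_const _)]
  refine norm_integral_le_of_norm_le hbd (Eventually.of_forall fun s => ?_)
  rw [← smul_sub, norm_smul]
  gcongr
  exact hbound s

theorem tendsto_integral_mul_min {f : ℝ → ℝ} (hf : Integrable f) {c : ℝ} (hc : 0 ≤ c) :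
    Tendsto (fun x : ℝ => ∫ s, ‖f s‖ * min (2 * c) (c * (|s| / x))) atTop (𝓝 0) := by
  rw [← integral_zero ℝ ℝ]
  refine tendsto_integral_filter_of_dominated_convergence (fun s => ‖f s‖ * (2 * c))
    (Eventually.of_forall fun x => ?_) ?_ (hf.norm.mul_const _) (Eventually.of_forall fun s => ?_)
  · have : Continuous fun s : ℝ => min (2 * c) (c * (|s| / x)) := by fun_prop
    exact hf.norm.aestronglyMeasurable.mul this.aestronglyMeasurable
  · filter_upwards [eventually_gt_atTop 0] with x hx
    refine Eventually.of_forall fun s => ?_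
    have h : 0 ≤ min (2 * c) (c * (|s| / x)) := by positivity
    rw [norm_mul, norm_norm, Real.norm_of_nonneg h]
    exact mul_le_mul_of_nonneg_left (min_le_left _ _) (norm_nonneg _)
  · have h1 : Tendsto (fun x : ℝ => c * (|s| / x)) atTop (𝓝 (c * 0)) :=
      (tendsto_const_nhds.div_atTop tendsto_id).const_mul c
    have h2 := ((tendsto_const_nhds (x := 2 * c)).min h1).const_mul ‖f s‖
    simpa [hc] using h2

/-- A weak* limit of Poisson functionals at points whose real parts tend to infinity is a
topologically invariant mean. -/
theorem isTopologicallyInvariantMean_of_tendsto {ι : Type*} {l : Filter ι} [l.NeBot]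
    {z : ι → rightHalfPlane} (hz : Tendsto (fun α => (z α : ℂ).re) l atTop)
    {Φ : StrongDual ℂ LInfty}
    (hΦ : ∀ φ, Tendsto (fun α => poissonFunctional (z α) φ) l (𝓝 (Φ φ))) :
    IsTopologicallyInvariantMean Φ where
  nonneg φ hφ := ge_of_tendsto' (hΦ φ) fun α => (isMean_poissonFunctional (z α)).nonneg φ hφ
  map_one := tendsto_nhds_unique (hΦ oneLInfty)
    (tendsto_const_nhds.congr fun α => (isMean_poissonFunctional (z α)).map_one.symm)
  map_conv f hf φ := by
    have h0 : Tendsto (fun α => poissonFunctional (z α) (conv f φ) - poissonFunctional (z α) φ) l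
        (𝓝 0) :=
      squeeze_zero_norm (fun α => norm_poissonFunctional_conv_sub_le (z α) hf φ)
        ((tendsto_integral_mul_min (L1.integrable_coeFn f) (norm_nonneg φ)).comp hz)
    exact sub_eq_zero.mp (tendsto_nhds_unique ((hΦ (conv f φ)).sub (hΦ φ)) h0)

/-- By the Banach-Alaoglu theorem, Poisson functionals converge weak* along every ultrafilter. -/
theorem exists_tendsto_poissonFunctional {ι : Type*} (U : Ultrafilter ι)
    (z : ι → rightHalfPlane) :
    ∃ Φ : StrongDual ℂ LInfty,
      ∀ φ, Tendsto (fun α => poissonFunctional (z α) φ) U (𝓝 (Φ φ)) := by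
  have hc := WeakDual.isCompact_closedBall (0 : StrongDual ℂ LInfty) 1
  obtain ⟨Φ, -, hΦ⟩ := hc.ultrafilter_le_nhds
    (U.map fun α => StrongDual.toWeakDual (poissonFunctional (z α))) <| by
      refine le_principal_iff.mpr (Eventually.of_forall (f := (U : Filter ι)) fun α => ?_)
      simpa using norm_poissonFunctional_le (z α)
  exact ⟨WeakDual.toStrongDual Φ, fun φ =>
    ((WeakDual.eval_continuous φ).tendsto Φ).comp hΦ⟩

end HalfPlane
end

theorem theorem4p3 {ι : Type*} [Preorder ι] [IsDirectedOrder ι] [Nonempty ι]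
    (z : ι → HalfPlane.rightHalfPlane) (χ : HalfPlane.MaximalIdealSpace)
    (hz : Tendsto (fun α => (z α : ℂ).re) atTop atTop)
    (hχ : Tendsto (fun α => HalfPlane.pointEval (z α)) atTop (𝓝 χ)) :
    ∃ Φ : StrongDual ℂ HalfPlane.LInfty, HalfPlane.IsTopologicallyInvariantMean Φ ∧
      ∀ φ : HalfPlane.HInfty, ∃ ψ : HalfPlane.LInfty,
        HalfPlane.IsBoundaryFunction φ ψ ∧ Φ ψ = χ φ := by
  obtain ⟨Φ, hΦ⟩ := HalfPlane.exists_tendsto_poissonFunctional (Ultrafilter.of atTop) z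
  have hle : (Ultrafilter.of (atTop : Filter ι) : Filter ι) ≤ atTop := Ultrafilter.of_le _
  refine ⟨Φ, HalfPlane.isTopologicallyInvariantMean_of_tendsto (hz.mono_left hle) hΦ,
    fun φ => ?_⟩
  obtain ⟨ψ, hψ, hrep⟩ := HalfPlane.exists_boundaryFunction φ
  -- By `hrep` the numbers `P_{z_α} ψ` are the values `φ(z_α)`, which tend to `χ φ` by weak*
  -- convergence of the evaluations.
  refine ⟨ψ, hψ, tendsto_nhds_unique (hΦ ψ) ?_⟩
  have hcont : Continuous fun η : HalfPlane.MaximalIdealSpace => η φ :=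
    (WeakDual.eval_continuous φ).comp continuous_subtype_val
  exact (((hcont.tendsto χ).comp hχ).mono_left hle).congr fun α => hrep (z α)
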